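/- For every $p\in(1,\infty)$ and $q\in(1,2]$ there is a constant $C(p,q)\in(0,\infty)$, depending only on $p$ and $q$, with the following properties. Let $X$ be a real normed space with modulus of smoothness of power type $q$, i.e. there is a constant $K$ such that for all $\tau>0$ $$\rho_X(\tau):=\sup\Bigl\{\tfrac{\|x+\tau y\|+\|x-\tau y\|}{2}-1:\ x,y\in X,\ \|x\|=\|y\|=1\Bigr\}\le K\tau^q$$ (with $\rho_X=0$ if $X=\{0\}$), and let $S_q(X)$ denote its $q$-smoothness constant, i.e. the least $S\ge 0$ such that $\|x+y\|^q+\|x-y\|^q\le 2\|x\|^q+2S^q\|y\|^q$ for all $x,y\in X$. Let $\{Z_t\}_{t=0}^\infty$ be a stationary reversible Markov chain on $\{1,\dots,n\}$, i.e. a time-homogeneous Markov chain with transition probabilities $a_{ij}$ such that $\pi_i=\Pr(Z_t=i)$ does not depend on $t$ and $\pi_i a_{ij}=\pi_j a_{ji}$ for all $i,j$, let $f:\{1,\dots,n\}\to X$, and let $t\ge 0$ be an integer. If $p\le q$, then $$\mathbb{E}\|f(Z_t)-f(Z_0)\|^p\le C(p,q)\,S_q(X)^q\,t\,\mathbb{E}\|f(Z_1)-f(Z_0)\|^p;$$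 in particular $X$ has Markov type $p$, i.e. there is a constant $M>0$ such that $\mathbb{E}\|f(Z_t)-f(Z_0)\|^p\le M^p\,t\,\mathbb{E}\|f(Z_1)-f(Z_0)\|^p$ for all such $n$, chains, maps $f$ and times $t$. If $p>q$, then $$\mathbb{E}\|f(Z_t)-f(Z_0)\|^p\le C(p,q)\,S_q(X)^p\,t^{p/q}\,\mathbb{E}\|f(Z_1)-f(Z_0)\|^p.$$ -/

import Mathlib

open MeasureTheory

/-! ### Uniform smoothness of normed spaces -/

/-- The set whose supremum is the modulus of smoothness at `τ`. -/
def smoothnessSet (X : Type*) [NormedAddCommGroup X] [NormedSpace ℝ X] (τ : ℝ) : Set ℝ :=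
  {r : ℝ | ∃ x y : X, ‖x‖ = 1 ∧ ‖y‖ = 1 ∧ r = (‖x + τ • y‖ + ‖x - τ • y‖) / 2 - 1}

/-- The supremum defining the modulus of smoothness is finite. -/
theorem bddAbove_smoothnessSet (X : Type*) [NormedAddCommGroup X] [NormedSpace ℝ X] (τ : ℝ) :
    BddAbove (smoothnessSet X τ) := by
  refine ⟨|τ|, ?_⟩
  rintro r ⟨x, y, hx, hy, rfl⟩
  have h1 := norm_add_le x (τ • y)
  have h2 := norm_sub_le x (τ • y)
  rw [norm_smul, hx, hy, Real.norm_eq_abs] at h1 h2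
  linarith

/-- The modulus of (uniform) smoothness
`ρ_X(τ) = sup {(‖x + τ y‖ + ‖x - τ y‖) / 2 - 1 : ‖x‖ = ‖y‖ = 1}`
(it is `0` for the zero space, where the set is empty). -/
noncomputable def modulusOfSmoothness (X : Type*) [NormedAddCommGroup X] [NormedSpace ℝ X]
    (τ : ℝ) : ℝ :=
  sSup (smoothnessSet X τ)

/-- `X` has modulus of smoothness of power type `q`: `ρ_X(τ) ≤ K τ ^ q` for all `τ > 0`. -/
def HasSmoothnessPowerType (X : Type*) [NormedAddCommGroup X] [NormedSpace ℝ X] (q : ℝ) : Prop :=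
  ∃ K : ℝ, ∀ τ : ℝ, 0 < τ → modulusOfSmoothness X τ ≤ K * τ ^ q

/-- The `q`-smoothness constant `S_q(X)`: the least `S ≥ 0` such that
`‖x + y‖ ^ q + ‖x - y‖ ^ q ≤ 2 ‖x‖ ^ q + 2 S ^ q ‖y‖ ^ q` for all `x, y`. -/
noncomputable def smoothnessConst (X : Type*) [NormedAddCommGroup X] [NormedSpace ℝ X]
    (q : ℝ) : ℝ :=
  sInf {S : ℝ | 0 ≤ S ∧
    ∀ x y : X, ‖x + y‖ ^ q + ‖x - y‖ ^ q ≤ 2 * ‖x‖ ^ q + 2 * S ^ q * ‖y‖ ^ q}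

/-! ### Finite-state Markov chains and Markov type -/

/-- On the probability space `(Ω, μ)`, the process `Z` is a (time-homogeneous) Markov chain on an
`n`-point state space with transition probabilities `A i j = Pr(Z_{t+1} = j | Z_t = i)`:
conditionally on any past `Z_0 = i_0, …, Z_t = i_t`, the probability of `Z_{t+1} = i_{t+1}` is
`A i_t i_{t+1}`. It is written in product form, so that pasts of probability zero need no
convention. -/
structure IsMarkovChain {Ω : Type*} [MeasurableSpace Ω] (μ : Measure Ω) {n : ℕ}
    (A : Matrix (Fin n) (Fin n) ℝ) (Z : ℕ → Ω → Fin n) : Prop where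
  measurable : ∀ t, Measurable (Z t)
  stochastic : A ∈ Matrix.rowStochastic ℝ (Fin n)
  markov : ∀ (t : ℕ) (i : ℕ → Fin n),
    μ.real {ω | ∀ s ≤ t + 1, Z s ω = i s} =
      μ.real {ω | ∀ s ≤ t, Z s ω = i s} * A (i t) (i (t + 1))

/-- A stationary reversible Markov chain: `π i = Pr(Z_t = i)` does not depend on `t`, and
`π i * A i j = π j * A j i` for all states `i, j`. -/
structure IsStationaryReversibleMarkovChain {Ω : Type*} [MeasurableSpace Ω] (μ : Measure Ω)
    {n : ℕ} (A : Matrix (Fin n) (Fin n) ℝ) (Z : ℕ → Ω → Fin n) : Prop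
    extends IsMarkovChain μ A Z where
  stationary : ∀ (t : ℕ) (i : Fin n), μ.real {ω | Z t ω = i} = μ.real {ω | Z 0 ω = i}
  reversible : ∀ i j : Fin n,
    μ.real {ω | Z 0 ω = i} * A i j = μ.real {ω | Z 0 ω = j} * A j i

universe u v

/-- The metric space `X` has Markov type `p`. The integrands take finitely many values, so the
integrals are genuine expectations. -/
def HasMarkovType (X : Type u) [MetricSpace X] (p : ℝ) : Prop :=
  ∃ K : ℝ, 0 < K ∧
    ∀ (Ω : Type v) [MeasurableSpace Ω] (μ : Measure Ω) [IsProbabilityMeasure μ]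
      (n : ℕ) (A : Matrix (Fin n) (Fin n) ℝ) (Z : ℕ → Ω → Fin n),
      IsStationaryReversibleMarkovChain μ A Z →
      ∀ (f : Fin n → X) (t : ℕ),
        ∫ ω, dist (f (Z t ω)) (f (Z 0 ω)) ^ p ∂μ ≤
          K ^ p * t * ∫ ω, dist (f (Z 1 ω)) (f (Z 0 ω)) ^ p ∂μ

/-!
For a stationary reversible chain `Z` and a function `f` with one-step average
`Lf i = 𝔼[f (Z_1) | Z_0 = i]`, let `M` be the martingale with differences `f (Z_{s+1}) - Lf (Z_s)`,
and `N` the same martingale for the time-reversed chain, whose differences are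
`f (Z_s) - Lf (Z_{s+1})`. Telescoping gives
`2 (f (Z_t) - f (Z_0)) = M_t - N_t + (f - Lf) (Z_t) - (f - Lf) (Z_0)`
(`two_smul_sub_eq_pathMartingale_sub`). By reversibility `M_t` and `N_t` have the same law
(`IsReversibleKernel.sum_path_rev`), and the boundary terms are controlled by one step of the chain
through Jensen's inequality, so it suffices to bound `𝔼 ‖M_t‖ ^ p`.

Both ranges of `p` use an inequality of one form: with `r = 1` if `p ≤ q` and `r = p / q` otherwise,
for all `m ≥ 1`,
`‖x + y‖ ^ p + ‖x - y‖ ^ p ≤ 2 (1 + 1 / (2 m)) ‖x‖ ^ p + 2 K m ^ (r - 1) ‖y‖ ^ p`,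
where `K` is a multiple of `S_q(X) ^ p` (`smooth_of_le`, `norm_rpow_add_norm_rpow_le_of_smooth`).
For `p > q` it follows from a second-order expansion of `(1 + s) ^ p`, the first-order term being
controlled by `q`-smoothness. Subtracting an independent copy replaces `± y` by an arbitrary
mean-zero increment (`sum_mul_norm_add_rpow_le`). Applied conditionally on the past with `m = t + 1`,
this gives a recursion for `𝔼 ‖M_t‖ ^ p` whose solution grows like `t ^ r`
(`IsReversibleKernel.sum_path_pathMartingale_le`).

Since the state space is finite, all of this takes place in finite sums over paths
(`IsMarkovChain.integral_path`). The definition of `S_q(X)` as an infimum is meaningful because the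
power type of the modulus of smoothness provides an admissible constant and the infimum is attained
(`HasSmoothnessPowerType.smoothnessConst_spec`).
-/

/-! ### Real inequalities -/

theorem add_rpow_le_two_rpow_mul {p a b : ℝ} (hp : 0 ≤ p) (ha : 0 ≤ a) (hb : 0 ≤ b) :
    (a + b) ^ p ≤ 2 ^ p * (a ^ p + b ^ p) := by
  have hm : a + b ≤ 2 * max a b := by linarith [le_max_left a b, le_max_right a b]
  have hap := Real.rpow_nonneg ha p
  have hbp := Real.rpow_nonneg hb p
  calc (a + b) ^ p ≤ (2 * max a b) ^ p := by gcongr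
    _ = 2 ^ p * max a b ^ p := Real.mul_rpow zero_le_two (le_max_of_le_left ha)
    _ ≤ 2 ^ p * (a ^ p + b ^ p) := by
      gcongr
      rcases max_choice a b with h | h <;> rw [h] <;> linarith

theorem norm_add_rpow_le {X : Type*} [SeminormedAddCommGroup X] {p : ℝ} (hp : 0 ≤ p) (x y : X) :
    ‖x + y‖ ^ p ≤ 2 ^ p * (‖x‖ ^ p + ‖y‖ ^ p) :=
  (Real.rpow_le_rpow (norm_nonneg _) (norm_add_le x y) hp).trans
    (add_rpow_le_two_rpow_mul hp (norm_nonneg _) (norm_nonneg _))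

theorem norm_sub_rpow_le {X : Type*} [SeminormedAddCommGroup X] {p : ℝ} (hp : 0 ≤ p) (x y : X) :
    ‖x - y‖ ^ p ≤ 2 ^ p * (‖x‖ ^ p + ‖y‖ ^ p) := by
  simpa [sub_eq_add_neg] using norm_add_rpow_le hp x (-y)

/-- Second-order expansion of `(1 + s) ^ p` on `[-1, 1]`, with an explicit constant. -/
theorem one_add_rpow_le {p s : ℝ} (hp : 1 ≤ p) (hs : |s| ≤ 1) :
    (1 + s) ^ p ≤ 1 + p * s + (2 ^ p + 1) * p ^ 2 * s ^ 2 := by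
  have hs' := abs_le.1 hs
  have h2 : (0 : ℝ) < 2 ^ p := by positivity
  by_cases h : |p * s| ≤ 1
  · have h1 : (1 + s) ^ p ≤ Real.exp (p * s) := by
      rw [mul_comm, Real.exp_mul]
      have := Real.add_one_le_exp s
      exact Real.rpow_le_rpow (by linarith) (by linarith) (by linarith)
    have h3 := (abs_le.1 (Real.abs_exp_sub_one_sub_id_le h)).2
    have : 0 ≤ 2 ^ p * (p * s) ^ 2 := by positivity
    nlinarith
  · -- Here `|p s| > 1`, so the quadratic term alone dominates.
    push Not at h
    have h1 : (1 + s) ^ p ≤ 2 ^ p :=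
      Real.rpow_le_rpow (by linarith) (by linarith) (by linarith)
    have h3 : |p * s| ≤ (p * s) ^ 2 := by rw [← sq_abs]; nlinarith
    have h4 := neg_abs_le (p * s)
    have h5 : 2 ^ p * 1 ≤ 2 ^ p * (p * s) ^ 2 := by gcongr; linarith
    nlinarith

/-- Passing from a first-order estimate on the average of two deviations `s, s'` to the `p`-th
powers. -/
theorem one_add_rpow_add_one_add_rpow_le {p q κ h s s' : ℝ} (hp : 1 ≤ p) (hq0 : 0 < q)
    (hq2 : q ≤ 2) (h0 : 0 ≤ h) (h1 : h ≤ 1) (hs : |s| ≤ h) (hs' : |s'| ≤ h)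
    (hsum : s + s' ≤ 2 * κ * h ^ q) :
    (1 + s) ^ p + (1 + s') ^ p ≤ 2 + 2 * (p * κ + (2 ^ p + 1) * p ^ 2) * h ^ q := by
  have e1 := one_add_rpow_le hp (hs.trans h1)
  have e2 := one_add_rpow_le hp (hs'.trans h1)
  have hh : h ^ 2 ≤ h ^ q := by
    rcases h0.eq_or_lt with rfl | hpos
    · rw [Real.zero_rpow hq0.ne']; norm_num
    · rw [← Real.rpow_two]
      exact Real.rpow_le_rpow_of_exponent_ge hpos h1 hq2
  have f1 : s ^ 2 ≤ h ^ q := (sq_le_sq' (by linarith [(abs_le.1 hs).1]) (abs_le.1 hs).2).trans hh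
  have f2 : s' ^ 2 ≤ h ^ q :=
    (sq_le_sq' (by linarith [(abs_le.1 hs').1]) (abs_le.1 hs').2).trans hh
  have hC : (0 : ℝ) ≤ (2 ^ p + 1) * p ^ 2 := by positivity
  have g1 := mul_le_mul_of_nonneg_left f1 hC
  have g2 := mul_le_mul_of_nonneg_left f2 hC
  have g3 := mul_le_mul_of_nonneg_left hsum (by linarith : (0 : ℝ) ≤ p)
  linarith

/-! ### Smoothness inequalities for powers of the norm -/

section Smoothness

variable {X : Type*} [NormedAddCommGroup X]

/-- First-order smoothness near `x` controls the `p`-th powers of the norm, for every `p ≥ 1`. -/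
theorem norm_rpow_add_norm_rpow_le_of_norm_add_norm_le {p q κ : ℝ} (hp : 1 ≤ p) (hq0 : 0 < q)
    (hq2 : q ≤ 2) {x y : X} (hx : x ≠ 0) (hyx : ‖y‖ ≤ ‖x‖)
    (h : ‖x + y‖ + ‖x - y‖ ≤ 2 * ‖x‖ + 2 * κ * (‖x‖ * (‖y‖ / ‖x‖) ^ q)) :
    ‖x + y‖ ^ p + ‖x - y‖ ^ p ≤
      2 * ‖x‖ ^ p + 2 * (p * κ + (2 ^ p + 1) * p ^ 2) * (‖x‖ ^ p * (‖y‖ / ‖x‖) ^ q) := by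
  have ha : 0 < ‖x‖ := norm_pos_iff.2 hx
  have key : ∀ z : X, ‖z‖ ^ p = ‖x‖ ^ p * (1 + (‖z‖ - ‖x‖) / ‖x‖) ^ p := fun z => by
    rw [show 1 + (‖z‖ - ‖x‖) / ‖x‖ = ‖z‖ / ‖x‖ by field_simp; ring,
      Real.div_rpow (norm_nonneg _) ha.le]
    field_simp
  have b1 : |(‖x + y‖ - ‖x‖) / ‖x‖| ≤ ‖y‖ / ‖x‖ := by
    rw [abs_div, abs_of_pos ha]
    gcongr
    simpa using abs_norm_sub_norm_le (x + y) x
  have b2 : |(‖x - y‖ - ‖x‖) / ‖x‖| ≤ ‖y‖ / ‖x‖ := by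
    rw [abs_div, abs_of_pos ha]
    gcongr
    simpa using abs_norm_sub_norm_le (x - y) x
  have b3 : (‖x + y‖ - ‖x‖) / ‖x‖ + (‖x - y‖ - ‖x‖) / ‖x‖ ≤ 2 * κ * (‖y‖ / ‖x‖) ^ q := by
    rw [← add_div, div_le_iff₀ ha]
    linarith
  have := mul_le_mul_of_nonneg_left (one_add_rpow_add_one_add_rpow_le hp hq0 hq2 (by positivity)
    ((div_le_one ha).2 hyx) b1 b2 b3) (Real.rpow_nonneg ha.le p)
  rw [key (x + y), key (x - y)]
  linarith

/-- When `‖x‖ ≤ ‖y‖` the triangle inequality suffices. -/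
theorem norm_rpow_add_norm_rpow_le_of_norm_le {p : ℝ} (hp : 0 ≤ p) {x y : X}
    (hxy : ‖x‖ ≤ ‖y‖) : ‖x + y‖ ^ p + ‖x - y‖ ^ p ≤ 2 * 2 ^ p * ‖y‖ ^ p := by
  have h1 : ‖x + y‖ ^ p ≤ (2 * ‖y‖) ^ p :=
    Real.rpow_le_rpow (norm_nonneg _) (by linarith [norm_add_le x y]) hp
  have h2 : ‖x - y‖ ^ p ≤ (2 * ‖y‖) ^ p :=
    Real.rpow_le_rpow (norm_nonneg _) (by linarith [norm_sub_le x y]) hp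
  rw [Real.mul_rpow zero_le_two (norm_nonneg _)] at h1 h2
  linarith

/-- The modulus of smoothness, written out for vectors that are not normalized. -/
theorem norm_add_norm_le_of_modulusOfSmoothness [NormedSpace ℝ X] {q K : ℝ}
    (hK : ∀ τ : ℝ, 0 < τ → modulusOfSmoothness X τ ≤ K * τ ^ q) {x y : X} (hx : x ≠ 0)
    (hy : y ≠ 0) :
    ‖x + y‖ + ‖x - y‖ ≤ 2 * ‖x‖ + 2 * K * (‖x‖ * (‖y‖ / ‖x‖) ^ q) := by
  have ha : 0 < ‖x‖ := norm_pos_iff.2 hx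
  have hb : 0 < ‖y‖ := norm_pos_iff.2 hy
  have hmem : (‖x‖⁻¹ * ‖x + y‖ + ‖x‖⁻¹ * ‖x - y‖) / 2 - 1 ∈ smoothnessSet X (‖y‖ / ‖x‖) := by
    refine ⟨‖x‖⁻¹ • x, ‖y‖⁻¹ • y, by simp [norm_smul, ha.ne'], by simp [norm_smul, hb.ne'], ?_⟩
    have e : (‖y‖ / ‖x‖) • ‖y‖⁻¹ • y = ‖x‖⁻¹ • y := by
      rw [smul_smul]
      congr 1
      field_simp
    rw [e, ← smul_add, ← smul_sub, norm_smul, norm_smul, norm_inv, norm_norm]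
  have h := (le_csSup (bddAbove_smoothnessSet X _) hmem).trans (hK _ (div_pos hb ha))
  have h2 := mul_le_mul_of_nonneg_left h ha.le
  have e2 : ‖x‖ * ((‖x‖⁻¹ * ‖x + y‖ + ‖x‖⁻¹ * ‖x - y‖) / 2 - 1) =
      (‖x + y‖ + ‖x - y‖) / 2 - ‖x‖ := by field_simp
  rw [e2] at h2
  linarith

/-- The set of admissible constants in the definition of `smoothnessConst X q` is nonempty. -/
theorem HasSmoothnessPowerType.exists_smooth [NormedSpace ℝ X] {q : ℝ} (hq : 1 < q) (hq2 : q ≤ 2)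
    (hX : HasSmoothnessPowerType X q) :
    ∃ S : ℝ, 0 ≤ S ∧
      ∀ x y : X, ‖x + y‖ ^ q + ‖x - y‖ ^ q ≤ 2 * ‖x‖ ^ q + 2 * S ^ q * ‖y‖ ^ q := by
  obtain ⟨K, hK⟩ := hX
  have hq0 : 0 < q := by linarith
  set c : ℝ := q * |K| + (2 ^ q + 1) * q ^ 2 + 2 ^ q with hc
  have hc0 : 0 ≤ c := by positivity
  have hcK : q * K + (2 ^ q + 1) * q ^ 2 ≤ c := by
    have := mul_le_mul_of_nonneg_left (le_abs_self K) hq0.le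
    have : (0 : ℝ) < 2 ^ q := by positivity
    linarith
  refine ⟨c ^ q⁻¹, by positivity, fun x y => ?_⟩
  rw [Real.rpow_inv_rpow hc0 hq0.ne']
  by_cases hy : y = 0
  · simp [hy, Real.zero_rpow hq0.ne']; linarith
  have hyq : 0 ≤ ‖y‖ ^ q := by positivity
  rcases le_total ‖x‖ ‖y‖ with hxy | hxy
  · have h1 := norm_rpow_add_norm_rpow_le_of_norm_le hq0.le hxy
    have : 0 ≤ ‖x‖ ^ q := by positivity
    have : (2 : ℝ) ^ q ≤ c := by
      have : 0 ≤ q * |K| + (2 ^ q + 1) * q ^ 2 := by positivity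
      linarith
    nlinarith
  · have ha : 0 < ‖x‖ := (norm_pos_iff.2 hy).trans_le hxy
    have h1 := norm_rpow_add_norm_rpow_le_of_norm_add_norm_le hq.le hq0 hq2 (norm_pos_iff.1 ha) hxy
      (norm_add_norm_le_of_modulusOfSmoothness hK (norm_pos_iff.1 ha) hy)
    rw [Real.div_rpow (norm_nonneg _) ha.le, mul_div_cancel₀ _ (by positivity)] at h1
    nlinarith

/-- The infimum defining `smoothnessConst X q` is attained. -/
theorem HasSmoothnessPowerType.smoothnessConst_spec [NormedSpace ℝ X] {q : ℝ} (hq : 1 < q)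
    (hq2 : q ≤ 2) (hX : HasSmoothnessPowerType X q) :
    0 ≤ smoothnessConst X q ∧ ∀ x y : X, ‖x + y‖ ^ q + ‖x - y‖ ^ q ≤
      2 * ‖x‖ ^ q + 2 * smoothnessConst X q ^ q * ‖y‖ ^ q := by
  refine IsClosed.csInf_mem (s := {S : ℝ | 0 ≤ S ∧
    ∀ x y : X, ‖x + y‖ ^ q + ‖x - y‖ ^ q ≤ 2 * ‖x‖ ^ q + 2 * S ^ q * ‖y‖ ^ q}) ?_
    (hX.exists_smooth hq hq2) ⟨0, fun S hS => hS.1⟩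
  have hc : Continuous fun S : ℝ => S ^ q := Real.continuous_rpow_const (by linarith)
  simp only [Set.ofPred_and, Set.ofPred_forall]
  exact isClosed_Ici.inter (isClosed_iInter fun x => isClosed_iInter fun y =>
    isClosed_le continuous_const (by fun_prop))

theorem one_le_of_smooth [Nontrivial X] {q S : ℝ} (hq : 0 < q) (hS0 : 0 ≤ S)
    (hS : ∀ x y : X, ‖x + y‖ ^ q + ‖x - y‖ ^ q ≤ 2 * ‖x‖ ^ q + 2 * S ^ q * ‖y‖ ^ q) :
    1 ≤ S := by
  obtain ⟨y, hy⟩ := exists_ne (0 : X)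
  have h := hS 0 y
  have hpos : 0 < ‖y‖ ^ q := Real.rpow_pos_of_pos (norm_pos_iff.2 hy) q
  simp only [zero_add, zero_sub, norm_neg, norm_zero, Real.zero_rpow hq.ne'] at h
  by_contra! hlt
  have := Real.rpow_lt_one hS0 hlt hq
  nlinarith

/-- `q`-smoothness implies first-order smoothness, by Bernoulli's inequality. -/
theorem norm_add_norm_le_of_smooth {q S : ℝ} (hq : 1 ≤ q)
    (hS : ∀ x y : X, ‖x + y‖ ^ q + ‖x - y‖ ^ q ≤ 2 * ‖x‖ ^ q + 2 * S ^ q * ‖y‖ ^ q)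
    (hS0 : 0 ≤ S) {x y : X} (hx : x ≠ 0) :
    ‖x + y‖ + ‖x - y‖ ≤ 2 * ‖x‖ + 2 * S ^ q * (‖x‖ * (‖y‖ / ‖x‖) ^ q) := by
  have ha : 0 < ‖x‖ := norm_pos_iff.2 hx
  have key : ∀ z : X, 1 + q * (‖z‖ / ‖x‖ - 1) ≤ ‖z‖ ^ q / ‖x‖ ^ q := fun z => by
    have hz : 0 ≤ ‖z‖ / ‖x‖ := by positivity
    have := one_add_mul_self_le_rpow_one_add (s := ‖z‖ / ‖x‖ - 1) (by linarith) hq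
    rwa [add_sub_cancel, Real.div_rpow (norm_nonneg _) ha.le] at this
  have h := div_le_div_of_nonneg_right (hS x y) (Real.rpow_nonneg ha.le q)
  have e : (2 * ‖x‖ ^ q + 2 * S ^ q * ‖y‖ ^ q) / ‖x‖ ^ q = 2 + 2 * S ^ q * (‖y‖ / ‖x‖) ^ q := by
    rw [Real.div_rpow (norm_nonneg _) ha.le]
    field_simp
  rw [add_div, e] at h
  have hR : 0 ≤ S ^ q * (‖y‖ / ‖x‖) ^ q := by positivity
  have h1 : ‖x + y‖ / ‖x‖ + ‖x - y‖ / ‖x‖ - 2 ≤ 2 * S ^ q * (‖y‖ / ‖x‖) ^ q := by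
    have := key (x + y)
    have := key (x - y)
    by_contra! hlt
    nlinarith
  have h2 := mul_le_mul_of_nonneg_left h1 ha.le
  have e2 : ‖x‖ * (‖x + y‖ / ‖x‖ + ‖x - y‖ / ‖x‖ - 2) = ‖x + y‖ + ‖x - y‖ - 2 * ‖x‖ := by
    field_simp
  rw [e2] at h2
  linarith

/-- For `p ≤ q`, `q`-smoothness implies `p`-smoothness with the same constant: the power mean
inequality together with the subadditivity of `u ↦ u ^ (p / q)`. -/
theorem smooth_of_le {p q S : ℝ} (hp : 0 < p) (hpq : p ≤ q) (hS0 : 0 ≤ S)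
    (hS : ∀ x y : X, ‖x + y‖ ^ q + ‖x - y‖ ^ q ≤ 2 * ‖x‖ ^ q + 2 * S ^ q * ‖y‖ ^ q) (x y : X) :
    ‖x + y‖ ^ p + ‖x - y‖ ^ p ≤ 2 * ‖x‖ ^ p + 2 * S ^ p * ‖y‖ ^ p := by
  have hq : 0 < q := hp.trans_le hpq
  have hr : p / q ≤ 1 := (div_le_one hq).2 hpq
  have hr0 : 0 ≤ p / q := by positivity
  have key : ∀ u : ℝ, 0 ≤ u → u ^ p = (u ^ q) ^ (p / q) := fun u hu => by
    rw [← Real.rpow_mul hu, mul_div_cancel₀ _ hq.ne']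
  have hmean : 1 / 2 * (‖x + y‖ ^ q) ^ (p / q) + 1 / 2 * (‖x - y‖ ^ q) ^ (p / q) ≤
      (1 / 2 * ‖x + y‖ ^ q + 1 / 2 * ‖x - y‖ ^ q) ^ (p / q) :=
    (Real.concaveOn_rpow hr0 hr).2 (Real.rpow_nonneg (norm_nonneg (x + y)) q)
      (Real.rpow_nonneg (norm_nonneg (x - y)) q) (by norm_num) (by norm_num) (by norm_num)
  have hle : (1 / 2 * ‖x + y‖ ^ q + 1 / 2 * ‖x - y‖ ^ q) ^ (p / q) ≤
      (‖x‖ ^ q + (S * ‖y‖) ^ q) ^ (p / q) := by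
    refine Real.rpow_le_rpow (by positivity) ?_ hr0
    rw [Real.mul_rpow hS0 (norm_nonneg _)]
    linarith [hS x y]
  have hsub : (‖x‖ ^ q + (S * ‖y‖) ^ q) ^ (p / q) ≤
      (‖x‖ ^ q) ^ (p / q) + ((S * ‖y‖) ^ q) ^ (p / q) :=
    Real.rpow_add_le_add_rpow (by positivity) (by positivity) hr0 hr
  rw [← key _ (norm_nonneg _), ← key _ (norm_nonneg _)] at hmean
  rw [← key _ (norm_nonneg _), ← key (S * ‖y‖) (by positivity)] at hsub
  have := hmean.trans (hle.trans hsub)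
  rw [Real.mul_rpow hS0 (norm_nonneg _)] at this
  linarith

/-- The case `p > q`: the term of order `S ^ q * ‖x‖ ^ (p - q) * ‖y‖ ^ q` is split, with a free
parameter `m`, into a small multiple of `‖x‖ ^ p` and a multiple of `‖y‖ ^ p`. -/
theorem norm_rpow_add_norm_rpow_le_of_smooth {p q S : ℝ} (hq : 1 < q) (hq2 : q ≤ 2)
    (hpq : q < p) (hS1 : 1 ≤ S)
    (hS : ∀ x y : X, ‖x + y‖ ^ q + ‖x - y‖ ^ q ≤ 2 * ‖x‖ ^ q + 2 * S ^ q * ‖y‖ ^ q)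
    {m : ℝ} (hm : 1 ≤ m) (x y : X) :
    ‖x + y‖ ^ p + ‖x - y‖ ^ p ≤ 2 * (1 + 1 / (2 * m)) * ‖x‖ ^ p +
      2 * ((2 * (p + (2 ^ p + 1) * p ^ 2)) ^ (p / q) * S ^ p) * m ^ (p / q - 1) * ‖y‖ ^ p := by
  have hq0 : 0 < q := by linarith
  have hp : 1 ≤ p := by linarith
  have hS0 : 0 ≤ S := by linarith
  have hr : 1 < p / q := (one_lt_div hq0).2 hpq
  have hSq : 1 ≤ S ^ q := Real.one_le_rpow hS1 hq0.le
  have h2p : (2 : ℝ) ^ p ≤ (2 ^ p + 1) * p ^ 2 := by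
    have h1 : (0 : ℝ) < 2 ^ p := by positivity
    have h2 : (1 : ℝ) ≤ p ^ 2 := one_le_pow₀ hp
    nlinarith
  set c : ℝ := p + (2 ^ p + 1) * p ^ 2 with hc
  have hc1 : 2 ^ p ≤ c := by linarith
  have hc0 : 1 ≤ c := by
    have : (0 : ℝ) < 2 ^ p := by positivity
    linarith
  have hm0 : 0 < m := by linarith
  have hxp : 0 ≤ 1 / (2 * m) * ‖x‖ ^ p := by positivity
  have hxp' : 0 ≤ ‖x‖ ^ p := by positivity
  by_cases hxy : ‖x‖ ≤ ‖y‖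
  · have h1 := norm_rpow_add_norm_rpow_le_of_norm_le (by linarith : 0 ≤ p) hxy
    have h2 : (2 : ℝ) ^ p ≤ (2 * c) ^ (p / q) * S ^ p * m ^ (p / q - 1) := by
      calc (2 : ℝ) ^ p ≤ 2 * c := by linarith
        _ ≤ (2 * c) ^ (p / q) := Real.self_le_rpow_of_one_le (by linarith) hr.le
        _ = (2 * c) ^ (p / q) * 1 * 1 := by ring
        _ ≤ _ := by
          gcongr
          · exact Real.one_le_rpow hS1 (by linarith)
          · exact Real.one_le_rpow hm (by linarith)
    have h3 := mul_le_mul_of_nonneg_right h2 (Real.rpow_nonneg (norm_nonneg y) p)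
    linarith
  · push Not at hxy
    have ha : 0 < ‖x‖ := (norm_nonneg y).trans_lt hxy
    have h1 := norm_rpow_add_norm_rpow_le_of_norm_add_norm_le hp hq0 hq2 (norm_pos_iff.1 ha)
      hxy.le (norm_add_norm_le_of_smooth hq.le hS hS0 (norm_pos_iff.1 ha))
    set h : ℝ := ‖y‖ / ‖x‖ with hh
    have hh0 : 0 ≤ h := by positivity
    set z : ℝ := S ^ q * h ^ q with hz
    have hz0 : 0 ≤ z := by positivity
    have hzr : z ^ (p / q) = S ^ p * h ^ p := by
      rw [hz, ← Real.mul_rpow hS0 hh0, ← Real.rpow_mul (by positivity),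
        mul_div_cancel₀ _ hq0.ne', Real.mul_rpow hS0 hh0]
    have h2 : (p * S ^ q + (2 ^ p + 1) * p ^ 2) * h ^ q ≤ c * z := by
      rw [hz, ← mul_assoc]
      gcongr
      have : 0 ≤ (2 ^ p + 1) * p ^ 2 := by positivity
      nlinarith
    have h3 : c * z ≤ 1 / (2 * m) + (2 * c) ^ (p / q) * m ^ (p / q - 1) * z ^ (p / q) := by
      by_cases hsmall : c * z ≤ 1 / (2 * m)
      · have : 0 ≤ (2 * c) ^ (p / q) * m ^ (p / q - 1) * z ^ (p / q) := by positivity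
        linarith
      · -- Here `2 c z m > 1`, so the factor `(2 c z m) ^ (p / q - 1) ≥ 1` may be inserted.
        push Not at hsmall
        rw [div_lt_iff₀ (by positivity)] at hsmall
        have hcz : 0 < 2 * c * z := by nlinarith
        calc c * z ≤ 2 * c * z * 1 := by linarith
          _ ≤ 2 * c * z * (2 * c * z * m) ^ (p / q - 1) := by
            gcongr
            exact Real.one_le_rpow (by linarith) (by linarith)
          _ = (2 * c) ^ (p / q) * m ^ (p / q - 1) * z ^ (p / q) := by
            rw [Real.mul_rpow hcz.le hm0.le, ← mul_assoc, ← Real.rpow_one_add' hcz.le (by linarith),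
              add_sub_cancel, Real.mul_rpow (by positivity) hz0]
            ring
          _ ≤ _ := by
            have : 0 ≤ 1 / (2 * m) := by positivity
            linarith
    have hhp : ‖x‖ ^ p * h ^ p = ‖y‖ ^ p := by
      rw [← Real.mul_rpow ha.le hh0, hh, mul_div_cancel₀ _ ha.ne']
    have h4 := mul_le_mul_of_nonneg_left (h2.trans h3) hxp'
    rw [hzr] at h4
    have e : ‖x‖ ^ p * (1 / (2 * m) + (2 * c) ^ (p / q) * m ^ (p / q - 1) * (S ^ p * h ^ p)) =
        1 / (2 * m) * ‖x‖ ^ p + (2 * c) ^ (p / q) * S ^ p * m ^ (p / q - 1) * ‖y‖ ^ p := by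
      rw [← hhp]; ring
    rw [e] at h4
    linarith

end Smoothness

/-! ### From symmetric to mean-zero perturbations -/

section Symmetrization

variable {X : Type*} [NormedAddCommGroup X] [NormedSpace ℝ X] {ι : Type*} [Fintype ι]

theorem norm_sum_smul_rpow_le {w : ι → ℝ} (hw0 : ∀ i, 0 ≤ w i) (hw1 : ∑ i, w i = 1) {p : ℝ}
    (hp : 1 ≤ p) (Y : ι → X) : ‖∑ i, w i • Y i‖ ^ p ≤ ∑ i, w i * ‖Y i‖ ^ p := by
  calc ‖∑ i, w i • Y i‖ ^ p ≤ (∑ i, w i * ‖Y i‖) ^ p := by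
        refine Real.rpow_le_rpow (norm_nonneg _) ((norm_sum_le _ _).trans_eq ?_) (by linarith)
        exact Finset.sum_congr rfl fun i _ => by rw [norm_smul, Real.norm_of_nonneg (hw0 i)]
    _ ≤ _ := Real.rpow_arith_mean_le_arith_mean_rpow _ _ _ (fun i _ => hw0 i) hw1
        (fun i _ => norm_nonneg _) hp

/-- A smoothness inequality for symmetric perturbations `±y` passes to mean-zero perturbations `Y`:
subtracting an independent copy `Y'` only increases `𝔼 ‖x + Y‖ ^ p`, and `Y - Y'` is symmetric. -/
theorem sum_mul_norm_add_rpow_le {w : ι → ℝ} (hw0 : ∀ i, 0 ≤ w i) (hw1 : ∑ i, w i = 1)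
    {Y : ι → X} (hY : ∑ i, w i • Y i = 0) {p α K : ℝ} (hp : 1 ≤ p) (hK : 0 ≤ K)
    (h : ∀ x y : X, ‖x + y‖ ^ p + ‖x - y‖ ^ p ≤ 2 * α * ‖x‖ ^ p + 2 * K * ‖y‖ ^ p) (x : X) :
    ∑ i, w i * ‖x + Y i‖ ^ p ≤ α * ‖x‖ ^ p + 2 * 2 ^ p * K * ∑ i, w i * ‖Y i‖ ^ p := by
  set T : ℝ := ∑ i, w i * ∑ j, w j * ‖x + (Y i - Y j)‖ ^ p with hT
  have hle : ∑ i, w i * ‖x + Y i‖ ^ p ≤ T := by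
    refine Finset.sum_le_sum fun i _ => mul_le_mul_of_nonneg_left ?_ (hw0 i)
    have e : ∑ j, w j • (x + (Y i - Y j)) = x + Y i := by
      simp only [smul_add, smul_sub, Finset.sum_add_distrib, Finset.sum_sub_distrib, hY,
        ← Finset.sum_smul, hw1, one_smul, sub_zero]
    simpa only [e] using norm_sum_smul_rpow_le hw0 hw1 hp fun j => x + (Y i - Y j)
  have hswap : T = ∑ i, w i * ∑ j, w j * ‖x - (Y i - Y j)‖ ^ p := by
    simp only [hT, Finset.mul_sum]
    rw [Finset.sum_comm]
    refine Finset.sum_congr rfl fun i _ => Finset.sum_congr rfl fun j _ => ?_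
    rw [show x + (Y j - Y i) = x - (Y i - Y j) by abel]
    ring
  have hsum : T + T ≤ ∑ i, w i * ∑ j, w j *
      (2 * α * ‖x‖ ^ p + 2 * K * (2 ^ p * (‖Y i‖ ^ p + ‖Y j‖ ^ p))) := by
    nth_rewrite 2 [hswap]
    rw [hT, ← Finset.sum_add_distrib]
    refine Finset.sum_le_sum fun i _ => ?_
    rw [← mul_add, ← Finset.sum_add_distrib]
    refine mul_le_mul_of_nonneg_left (Finset.sum_le_sum fun j _ => ?_) (hw0 i)
    rw [← mul_add]
    refine mul_le_mul_of_nonneg_left ((h x _).trans ?_) (hw0 j)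
    gcongr
    exact norm_sub_rpow_le (by linarith) _ _
  have hin : ∀ i, ∑ j, w j * (2 * α * ‖x‖ ^ p + 2 * K * (2 ^ p * (‖Y i‖ ^ p + ‖Y j‖ ^ p))) =
      (2 * α * ‖x‖ ^ p + 2 * K * 2 ^ p * ∑ j, w j * ‖Y j‖ ^ p) + 2 * K * 2 ^ p * ‖Y i‖ ^ p := by
    intro i
    have e : ∀ j, w j * (2 * α * ‖x‖ ^ p + 2 * K * (2 ^ p * (‖Y i‖ ^ p + ‖Y j‖ ^ p))) =
        w j * (2 * α * ‖x‖ ^ p + 2 * K * 2 ^ p * ‖Y i‖ ^ p) +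
          2 * K * 2 ^ p * (w j * ‖Y j‖ ^ p) := fun j => by ring
    simp only [e, Finset.sum_add_distrib, ← Finset.sum_mul, ← Finset.mul_sum, hw1]
    ring
  have hout : ∑ i, w i * ∑ j, w j *
      (2 * α * ‖x‖ ^ p + 2 * K * (2 ^ p * (‖Y i‖ ^ p + ‖Y j‖ ^ p))) =
      2 * α * ‖x‖ ^ p + 2 * (2 * 2 ^ p * K * ∑ i, w i * ‖Y i‖ ^ p) := by
    have e : ∀ i, w i * (2 * K * 2 ^ p * ‖Y i‖ ^ p) = 2 * K * 2 ^ p * (w i * ‖Y i‖ ^ p) :=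
      fun i => by ring
    simp only [hin]
    simp only [mul_add (w _), e, Finset.sum_add_distrib, ← Finset.sum_mul, ← Finset.mul_sum,
      hw1]
    ring
  linarith

end Symmetrization

/-! ### Paths of a reversible chain -/

section Paths

variable {σ : Type*}

/-- The probability `π (i 0) * A (i 0) (i 1) * ⋯ * A (i (t - 1)) (i t)` of the path `i`. -/
def pathWeight (π : σ → ℝ) (A : Matrix σ σ ℝ) {t : ℕ} (i : Fin (t + 1) → σ) : ℝ :=
  π (i 0) * ∏ s : Fin t, A (i s.castSucc) (i s.succ)

variable {π : σ → ℝ} {A : Matrix σ σ ℝ}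

theorem pathWeight_snoc {t : ℕ} (i : Fin (t + 1) → σ) (j : σ) :
    pathWeight π A (Fin.snoc i j : Fin (t + 2) → σ) = pathWeight π A i * A (i (Fin.last t)) j := by
  unfold pathWeight
  rw [Fin.prod_univ_castSucc]
  simp only [Fin.snoc_castSucc, Fin.succ_last, Fin.snoc_last, Fin.succ_castSucc, ← mul_assoc]
  rw [show (0 : Fin (t + 2)) = Fin.castSucc 0 from rfl, Fin.snoc_castSucc]

variable [Fintype σ]

theorem sum_path_snoc {t : ℕ} (F : (Fin (t + 2) → σ) → ℝ) :
    ∑ i, pathWeight π A i * F i =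
      ∑ i : Fin (t + 1) → σ, pathWeight π A i *
        ∑ j, A (i (Fin.last t)) j * F (Fin.snoc i j) := by
  rw [← (Fin.snocEquiv fun _ : Fin (t + 2) => σ).sum_comp, Fintype.sum_prod_type, Finset.sum_comm]
  refine Finset.sum_congr rfl fun i _ => ?_
  rw [Finset.mul_sum]
  refine Finset.sum_congr rfl fun j _ => ?_
  have e : (Fin.snocEquiv fun _ : Fin (t + 2) => σ) (j, i) = Fin.snoc i j := rfl
  rw [e, pathWeight_snoc, mul_assoc]

/-- `A` is a stochastic matrix that is reversible with respect to the nonnegative weights `π`.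
The total mass of `π` is irrelevant. -/
structure IsReversibleKernel (π : σ → ℝ) (A : Matrix σ σ ℝ) : Prop where
  weight_nonneg : ∀ i, 0 ≤ π i
  nonneg : ∀ i j, 0 ≤ A i j
  sum_row : ∀ i, ∑ j, A i j = 1
  reversible : ∀ i j, π i * A i j = π j * A j i

namespace IsReversibleKernel

theorem pathWeight_nonneg (h : IsReversibleKernel π A) {t : ℕ} (i : Fin (t + 1) → σ) :
    0 ≤ pathWeight π A i :=
  mul_nonneg (h.weight_nonneg _) (Finset.prod_nonneg fun _ _ => h.nonneg _ _)

theorem sum_weight_mul (h : IsReversibleKernel π A) (F : σ → ℝ) :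
    ∑ i, π i * ∑ j, A i j * F j = ∑ j, π j * F j := by
  simp only [Finset.mul_sum]
  rw [Finset.sum_comm]
  refine Finset.sum_congr rfl fun j _ => ?_
  simp only [← mul_assoc, h.reversible _ j, ← Finset.sum_mul, ← Finset.mul_sum, h.sum_row, mul_one]

/-- Stationarity: the last point of a path is distributed according to `π`. -/
theorem sum_path_last (h : IsReversibleKernel π A) (F : σ → ℝ) (t : ℕ) :
    ∑ i : Fin (t + 1) → σ, pathWeight π A i * F (i (Fin.last t)) = ∑ i, π i * F i := by
  induction t generalizing F with
  | zero =>
    rw [← (Equiv.funUnique (Fin 1) σ).symm.sum_comp]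
    simp [pathWeight]
  | succ t ih =>
    rw [sum_path_snoc]
    simp only [Fin.snoc_last]
    rw [ih fun i => ∑ j, A i j * F j, h.sum_weight_mul]

/-- Reversing time does not change the probability of a path. -/
theorem pathWeight_rev (h : IsReversibleKernel π A) {t : ℕ} (i : Fin (t + 1) → σ) :
    pathWeight π A (i ∘ Fin.rev) = pathWeight π A i := by
  have key : ∀ {t : ℕ} (i : Fin (t + 1) → σ), π (i 0) * ∏ s : Fin t, A (i s.castSucc) (i s.succ) =
      π (i (Fin.last t)) * ∏ s : Fin t, A (i s.succ) (i s.castSucc) := by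
    intro t i
    induction t with
    | zero => simp
    | succ t ih =>
      have := ih fun s => i s.castSucc
      simp only [Fin.castSucc_zero] at this
      rw [Fin.prod_univ_castSucc, Fin.prod_univ_castSucc, ← mul_assoc]
      simp only [Fin.succ_castSucc, Fin.succ_last]
      rw [this]
      linear_combination (∏ s : Fin t, A (i s.succ.castSucc) (i s.castSucc.castSucc)) *
        h.reversible (i (Fin.last t).castSucc) (i (Fin.last (t + 1)))
  unfold pathWeight
  rw [key i, ← Equiv.prod_comp Fin.revPerm]
  simp [Fin.rev_castSucc, Fin.rev_succ]

theorem sum_path_rev (h : IsReversibleKernel π A) {t : ℕ} (F : (Fin (t + 1) → σ) → ℝ) :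
    ∑ i, pathWeight π A i * F (i ∘ Fin.rev) = ∑ i, pathWeight π A i * F i := by
  rw [← (Equiv.arrowCongr (Fin.revPerm (n := t + 1)) (Equiv.refl σ)).sum_comp]
  refine Finset.sum_congr rfl fun i _ => ?_
  have e : (Equiv.arrowCongr (Fin.revPerm (n := t + 1)) (Equiv.refl σ)) i = i ∘ Fin.rev := rfl
  have e2 : (i ∘ Fin.rev) ∘ Fin.rev = i := by ext s; simp
  rw [e, e2, h.pathWeight_rev]

theorem sum_path_zero (h : IsReversibleKernel π A) (F : σ → ℝ) (t : ℕ) :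
    ∑ i : Fin (t + 1) → σ, pathWeight π A i * F (i 0) = ∑ i, π i * F i := by
  rw [← h.sum_path_last F t, ← h.sum_path_rev]
  simp

end IsReversibleKernel

/-! ### The martingale part of a function of the chain -/

variable {X : Type*} [NormedAddCommGroup X]

/-- The moment `𝔼 ‖f (Z_1) - f (Z_0)‖ ^ p`. -/
noncomputable def stepMoment (π : σ → ℝ) (A : Matrix σ σ ℝ) (f : σ → X) (p : ℝ) : ℝ :=
  ∑ i, π i * ∑ j, A i j * ‖f j - f i‖ ^ p

theorem IsReversibleKernel.stepMoment_nonneg {p : ℝ} (h : IsReversibleKernel π A) (f : σ → X) :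
    0 ≤ stepMoment π A f p :=
  Finset.sum_nonneg fun i _ => mul_nonneg (h.weight_nonneg i) <|
    Finset.sum_nonneg fun j _ => mul_nonneg (h.nonneg i j) (by positivity)

variable [NormedSpace ℝ X]

/-- The conditional expectation of `f (Z_{t+1})` given that `Z_t = i`. -/
def markovAverage (A : Matrix σ σ ℝ) (f : σ → X) (i : σ) : X :=
  ∑ j, A i j • f j

/-- The value along the path `i` of the martingale with differences
`f (Z_{s+1}) - 𝔼[f (Z_{s+1}) | Z_s]`. -/
def pathMartingale (A : Matrix σ σ ℝ) (f : σ → X) {t : ℕ} (i : Fin (t + 1) → σ) : X :=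
  ∑ s : Fin t, (f (i s.succ) - markovAverage A f (i s.castSucc))

theorem pathMartingale_snoc (f : σ → X) {t : ℕ} (i : Fin (t + 1) → σ) (j : σ) :
    pathMartingale A f (Fin.snoc i j : Fin (t + 2) → σ) =
      pathMartingale A f i + (f j - markovAverage A f (i (Fin.last t))) := by
  unfold pathMartingale
  rw [Fin.sum_univ_castSucc]
  simp only [Fin.snoc_castSucc, Fin.succ_last, Fin.snoc_last, Fin.succ_castSucc]

theorem Fin.sum_succ_sub_castSucc {G : Type*} [AddCommGroup G] {t : ℕ} (g : Fin (t + 1) → G) :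
    ∑ s : Fin t, (g s.succ - g s.castSucc) = g (Fin.last t) - g 0 := by
  induction t with
  | zero => simp
  | succ t ih =>
    have := ih fun s => g s.castSucc
    simp only [Fin.castSucc_zero] at this
    rw [Fin.sum_univ_castSucc]
    simp only [Fin.succ_castSucc, Fin.succ_last]
    rw [this]
    abel

/-- The forward and the time-reversed martingale together recover twice the increment of `f` along
the path, up to two boundary terms. -/
theorem two_smul_sub_eq_pathMartingale_sub (f : σ → X) {t : ℕ} (i : Fin (t + 1) → σ) :
    (2 : ℝ) • (f (i (Fin.last t)) - f (i 0)) =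
      (pathMartingale A f i - pathMartingale A f (i ∘ Fin.rev)) +
        ((f (i (Fin.last t)) - markovAverage A f (i (Fin.last t))) -
          (f (i 0) - markovAverage A f (i 0))) := by
  have hrev : pathMartingale A f (i ∘ Fin.rev) =
      ∑ s : Fin t, (f (i s.castSucc) - markovAverage A f (i s.succ)) := by
    unfold pathMartingale
    rw [← Equiv.sum_comp Fin.revPerm]
    simp [Fin.rev_castSucc, Fin.rev_succ]
  have hsum : pathMartingale A f i - pathMartingale A f (i ∘ Fin.rev) =
      (f (i (Fin.last t)) + markovAverage A f (i (Fin.last t))) -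
        (f (i 0) + markovAverage A f (i 0)) := by
    rw [← Fin.sum_succ_sub_castSucc fun s => f (i s) + markovAverage A f (i s), hrev]
    unfold pathMartingale
    rw [← Finset.sum_sub_distrib]
    exact Finset.sum_congr rfl fun s _ => by abel
  rw [hsum, two_smul]
  abel

namespace IsReversibleKernel

variable {p : ℝ}

theorem norm_sub_markovAverage_rpow_le (h : IsReversibleKernel π A) (hp : 1 ≤ p) (f : σ → X)
    (i : σ) : ‖f i - markovAverage A f i‖ ^ p ≤ ∑ j, A i j * ‖f j - f i‖ ^ p := by
  have e : markovAverage A f i - f i = ∑ j, A i j • (f j - f i) := by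
    simp only [smul_sub, Finset.sum_sub_distrib, ← Finset.sum_smul, h.sum_row, one_smul,
      markovAverage]
  rw [norm_sub_rev, e]
  exact norm_sum_smul_rpow_le (h.nonneg i) (h.sum_row i) hp _

theorem sum_norm_sub_markovAverage_rpow_le (h : IsReversibleKernel π A) (hp : 1 ≤ p)
    (f : σ → X) : ∑ i, π i * ‖f i - markovAverage A f i‖ ^ p ≤ stepMoment π A f p :=
  Finset.sum_le_sum fun i _ =>
    mul_le_mul_of_nonneg_left (h.norm_sub_markovAverage_rpow_le hp f i) (h.weight_nonneg i)

theorem sum_markovDifference_rpow_le (h : IsReversibleKernel π A) (hp : 1 ≤ p) (f : σ → X) :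
    ∑ i, π i * ∑ j, A i j * ‖f j - markovAverage A f i‖ ^ p ≤
      2 * 2 ^ p * stepMoment π A f p := by
  unfold stepMoment
  rw [Finset.mul_sum]
  refine Finset.sum_le_sum fun i _ => ?_
  rw [mul_left_comm]
  refine mul_le_mul_of_nonneg_left ?_ (h.weight_nonneg i)
  calc ∑ j, A i j * ‖f j - markovAverage A f i‖ ^ p
      ≤ ∑ j, A i j * (2 ^ p * (‖f j - f i‖ ^ p + ‖f i - markovAverage A f i‖ ^ p)) := by
        refine Finset.sum_le_sum fun j _ => mul_le_mul_of_nonneg_left ?_ (h.nonneg i j)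
        rw [← sub_add_sub_cancel (f j) (f i)]
        exact norm_add_rpow_le (by linarith) _ _
    _ = 2 ^ p * (∑ j, A i j * ‖f j - f i‖ ^ p + ‖f i - markovAverage A f i‖ ^ p) := by
        simp only [mul_left_comm (A i _), mul_add, Finset.sum_add_distrib, ← Finset.mul_sum,
          ← Finset.sum_mul, h.sum_row, one_mul]
    _ ≤ 2 ^ p * (∑ j, A i j * ‖f j - f i‖ ^ p + ∑ j, A i j * ‖f j - f i‖ ^ p) := by
        gcongr
        exact h.norm_sub_markovAverage_rpow_le hp f i
    _ = _ := by ring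

/-- One step of the martingale: condition on the path up to time `t`. -/
theorem sum_path_pathMartingale_succ_le (h : IsReversibleKernel π A) (hp : 1 ≤ p) {α K : ℝ}
    (hK : 0 ≤ K)
    (hX : ∀ x y : X, ‖x + y‖ ^ p + ‖x - y‖ ^ p ≤ 2 * α * ‖x‖ ^ p + 2 * K * ‖y‖ ^ p)
    (f : σ → X) (t : ℕ) :
    ∑ i : Fin (t + 2) → σ, pathWeight π A i * ‖pathMartingale A f i‖ ^ p ≤
      α * ∑ i : Fin (t + 1) → σ, pathWeight π A i * ‖pathMartingale A f i‖ ^ p +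
        4 * 4 ^ p * K * stepMoment π A f p := by
  have hmean : ∀ i, ∑ j, A i j • (f j - markovAverage A f i) = 0 := fun i => by
    simp only [smul_sub, Finset.sum_sub_distrib, ← Finset.sum_smul, h.sum_row, one_smul]
    exact sub_self _
  rw [sum_path_snoc]
  calc _ ≤ ∑ i : Fin (t + 1) → σ, pathWeight π A i * (α * ‖pathMartingale A f i‖ ^ p +
        2 * 2 ^ p * K * ∑ j, A (i (Fin.last t)) j *
          ‖f j - markovAverage A f (i (Fin.last t))‖ ^ p) := by
        refine Finset.sum_le_sum fun i _ =>
          mul_le_mul_of_nonneg_left ?_ (h.pathWeight_nonneg i)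
        simp only [pathMartingale_snoc]
        exact sum_mul_norm_add_rpow_le (h.nonneg _) (h.sum_row _) (hmean _) hp hK hX _
    _ = α * ∑ i : Fin (t + 1) → σ, pathWeight π A i * ‖pathMartingale A f i‖ ^ p +
        2 * 2 ^ p * K * ∑ i, π i * ∑ j, A i j * ‖f j - markovAverage A f i‖ ^ p := by
        rw [← h.sum_path_last (fun i => ∑ j, A i j * ‖f j - markovAverage A f i‖ ^ p) t]
        simp only [mul_add, Finset.sum_add_distrib, mul_left_comm (pathWeight π A _),
          ← Finset.mul_sum]
    _ ≤ α * ∑ i : Fin (t + 1) → σ, pathWeight π A i * ‖pathMartingale A f i‖ ^ p +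
        2 * 2 ^ p * K * (2 * 2 ^ p * stepMoment π A f p) := by
        gcongr
        exact h.sum_markovDifference_rpow_le hp f
    _ = _ := by
        rw [show (4 : ℝ) = 2 * 2 by norm_num, Real.mul_rpow zero_le_two zero_le_two]
        ring

/-- Growth of the moments of the martingale. At time `t + 1` the smoothness inequality is used with
parameter `m = t + 1`; the induction then closes because
`(t + 1) ^ r - t ^ r ≥ (t + 1) ^ (r - 1)`. -/
theorem sum_path_pathMartingale_le (h : IsReversibleKernel π A) (hp : 1 ≤ p) {r K : ℝ}
    (hr : 1 ≤ r) (hK : 0 ≤ K)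
    (hX : ∀ m : ℝ, 1 ≤ m → ∀ x y : X, ‖x + y‖ ^ p + ‖x - y‖ ^ p ≤
      2 * (1 + 1 / (2 * m)) * ‖x‖ ^ p + 2 * K * m ^ (r - 1) * ‖y‖ ^ p)
    (f : σ → X) (t : ℕ) :
    ∑ i : Fin (t + 1) → σ, pathWeight π A i * ‖pathMartingale A f i‖ ^ p ≤
      8 * 4 ^ p * K * (t : ℝ) ^ r * stepMoment π A f p := by
  induction t with
  | zero =>
    simp [pathMartingale, Real.zero_rpow (by linarith : p ≠ 0),
      Real.zero_rpow (by linarith : r ≠ 0)]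
  | succ t ih =>
    have ht : (0 : ℝ) < (t : ℝ) + 1 := by positivity
    have hD := h.stepMoment_nonneg (p := p) f
    have hstep := h.sum_path_pathMartingale_succ_le hp
      (mul_nonneg hK (Real.rpow_nonneg ht.le (r - 1)))
      (fun x y => by simpa only [mul_assoc] using hX (t + 1) (by simp) x y) f t
    set E : ℝ := 4 * 4 ^ p * K * stepMoment π A f p with hE
    have hE0 : 0 ≤ E := by positivity
    set R : ℝ := ((t : ℝ) + 1) ^ (r - 1) with hR
    have hR0 : 0 ≤ R := by positivity
    have hsplit : ∀ u : ℝ, 0 ≤ u → u ^ r = u * u ^ (r - 1) := fun u hu => by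
      rw [← Real.rpow_one_add' hu (by linarith), add_sub_cancel]
    have htr : (t : ℝ) ^ r ≤ t * R := by
      rw [hsplit _ (Nat.cast_nonneg t)]
      exact mul_le_mul_of_nonneg_left (Real.rpow_le_rpow (Nat.cast_nonneg t) (by linarith)
        (by linarith)) (Nat.cast_nonneg t)
    have hfrac : (1 + 1 / (2 * ((t : ℝ) + 1))) * t ≤ t + 1 / 2 := by
      have : (1 + 1 / (2 * ((t : ℝ) + 1))) * t = t + (1 - 1 / ((t : ℝ) + 1)) / 2 := by
        field_simp
        ring
      have : 0 ≤ 1 / ((t : ℝ) + 1) := by positivity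
      linarith
    push_cast
    calc _ ≤ _ := hstep
      _ ≤ (1 + 1 / (2 * ((t : ℝ) + 1))) * (2 * E * (t * R)) + E * R := by
        refine add_le_add (mul_le_mul_of_nonneg_left (ih.trans ?_) (by positivity)) (le_of_eq ?_)
        · calc _ = 2 * E * (t : ℝ) ^ r := by rw [hE]; ring
            _ ≤ _ := by gcongr
        · rw [hE]; ring
      _ = ((1 + 1 / (2 * ((t : ℝ) + 1))) * t) * (2 * E * R) + E * R := by ring
      _ ≤ (t + 1 / 2) * (2 * E * R) + E * R := by gcongr
      _ = _ := by rw [hsplit _ ht.le, ← hR, hE]; ring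

theorem sum_path_norm_sub_rpow_le (h : IsReversibleKernel π A) (hp : 1 ≤ p) {r K : ℝ}
    (hr : 1 ≤ r) (hK : 1 ≤ K)
    (hX : ∀ m : ℝ, 1 ≤ m → ∀ x y : X, ‖x + y‖ ^ p + ‖x - y‖ ^ p ≤
      2 * (1 + 1 / (2 * m)) * ‖x‖ ^ p + 2 * K * m ^ (r - 1) * ‖y‖ ^ p)
    (f : σ → X) (t : ℕ) :
    ∑ i : Fin (t + 1) → σ, pathWeight π A i * ‖f (i (Fin.last t)) - f (i 0)‖ ^ p ≤
      4 ^ p * (16 * 4 ^ p + 2) * K * (t : ℝ) ^ r * stepMoment π A f p := by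
  -- At `t = 0` the boundary terms are not dominated by the right-hand side, but the increment
  -- itself is `0`.
  rcases Nat.eq_zero_or_pos t with rfl | ht
  · simp [Real.zero_rpow (by linarith : p ≠ 0), Real.zero_rpow (by linarith : r ≠ 0)]
  have hp0 : 0 ≤ p := by linarith
  have hD := h.stepMoment_nonneg (p := p) f
  set g : σ → X := fun i => f i - markovAverage A f i with hg
  have hpt : ∀ i : Fin (t + 1) → σ, ‖f (i (Fin.last t)) - f (i 0)‖ ^ p ≤
      4 ^ p * (‖pathMartingale A f i‖ ^ p + ‖pathMartingale A f (i ∘ Fin.rev)‖ ^ p +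
        ‖g (i (Fin.last t))‖ ^ p + ‖g (i 0)‖ ^ p) := by
    intro i
    have h1 : ‖f (i (Fin.last t)) - f (i 0)‖ ≤ ‖(2 : ℝ) • (f (i (Fin.last t)) - f (i 0))‖ := by
      rw [norm_smul, Real.norm_two]
      linarith [norm_nonneg (f (i (Fin.last t)) - f (i 0))]
    have h2 := Real.rpow_le_rpow (norm_nonneg _) h1 hp0
    rw [two_smul_sub_eq_pathMartingale_sub (A := A)] at h2
    refine (h2.trans (norm_add_rpow_le hp0 _ _)).trans ?_
    have h3 := norm_sub_rpow_le hp0 (pathMartingale A f i) (pathMartingale A f (i ∘ Fin.rev))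
    have h4 := norm_sub_rpow_le hp0 (g (i (Fin.last t))) (g (i 0))
    calc _ ≤ (2 : ℝ) ^ p *
          (2 ^ p * (‖pathMartingale A f i‖ ^ p + ‖pathMartingale A f (i ∘ Fin.rev)‖ ^ p) +
            2 ^ p * (‖g (i (Fin.last t))‖ ^ p + ‖g (i 0)‖ ^ p)) := by gcongr
      _ = _ := by
        rw [show (4 : ℝ) = 2 * 2 by norm_num, Real.mul_rpow zero_le_two zero_le_two]
        ring
  have hM := h.sum_path_pathMartingale_le hp hr (by linarith) hX f t
  have hL := h.sum_norm_sub_markovAverage_rpow_le hp f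
  have htr : (1 : ℝ) ≤ K * (t : ℝ) ^ r :=
    one_le_mul_of_one_le_of_one_le hK
      (Real.one_le_rpow (by exact_mod_cast ht) (by linarith))
  calc _ ≤ ∑ i : Fin (t + 1) → σ, pathWeight π A i *
        (4 ^ p * (‖pathMartingale A f i‖ ^ p + ‖pathMartingale A f (i ∘ Fin.rev)‖ ^ p +
          ‖g (i (Fin.last t))‖ ^ p + ‖g (i 0)‖ ^ p)) :=
        Finset.sum_le_sum fun i _ => mul_le_mul_of_nonneg_left (hpt i) (h.pathWeight_nonneg i)
    _ = 4 ^ p * (2 * (∑ i : Fin (t + 1) → σ, pathWeight π A i * ‖pathMartingale A f i‖ ^ p) +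
          2 * ∑ i, π i * ‖g i‖ ^ p) := by
        simp only [mul_left_comm (pathWeight π A _), mul_add, Finset.sum_add_distrib,
          ← Finset.mul_sum]
        rw [h.sum_path_rev fun i => ‖pathMartingale A f i‖ ^ p,
          h.sum_path_last fun i => ‖g i‖ ^ p, h.sum_path_zero fun i => ‖g i‖ ^ p]
        ring
    _ ≤ 4 ^ p * (2 * (8 * 4 ^ p * K * (t : ℝ) ^ r * stepMoment π A f p) +
          2 * (K * (t : ℝ) ^ r * stepMoment π A f p)) := by
        gcongr
        exact hL.trans (le_mul_of_one_le_left hD htr)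
    _ = _ := by ring

end IsReversibleKernel

end Paths

/-! ### Expectations as sums over paths -/

section Chains

variable {Ω : Type*} [MeasurableSpace Ω] {μ : Measure Ω} {n : ℕ} {A : Matrix (Fin n) (Fin n) ℝ}
  {Z : ℕ → Ω → Fin n}

theorem IsMarkovChain.real_path (hZ : IsMarkovChain μ A Z) (t : ℕ) (i : ℕ → Fin n) :
    μ.real {ω | ∀ s ≤ t, Z s ω = i s} =
      μ.real {ω | Z 0 ω = i 0} * ∏ s ∈ Finset.range t, A (i s) (i (s + 1)) := by
  induction t with
  | zero => simp
  | succ t ih => rw [hZ.markov, ih, Finset.prod_range_succ, mul_assoc]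

/-- Expectations of functions of `Z_0, …, Z_t` are weighted sums over paths. -/
theorem IsMarkovChain.integral_path [IsProbabilityMeasure μ] (hZ : IsMarkovChain μ A Z) (t : ℕ)
    (F : (Fin (t + 1) → Fin n) → ℝ) :
    ∫ ω, F (fun s => Z s ω) ∂μ =
      ∑ i, pathWeight (fun j => μ.real {ω | Z 0 ω = j}) A i * F i := by
  have hmeas : Measurable fun ω => fun s : Fin (t + 1) => Z s ω :=
    measurable_pi_lambda _ fun s => hZ.measurable s
  have : IsProbabilityMeasure (μ.map fun ω => fun s : Fin (t + 1) => Z s ω) :=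
    Measure.isProbabilityMeasure_map hmeas.aemeasurable
  rw [← integral_map (φ := fun ω => fun s : Fin (t + 1) => Z s ω) hmeas.aemeasurable
    (measurable_of_finite F).aestronglyMeasurable, integral_fintype .of_finite]
  refine Finset.sum_congr rfl fun i _ => ?_
  rw [smul_eq_mul, map_measureReal_apply hmeas (measurableSet_singleton i)]
  congr 1
  have hset : (fun ω => fun s : Fin (t + 1) => Z s ω) ⁻¹' {i} =
      {ω | ∀ s ≤ t, Z s ω = i (Fin.ofNat (t + 1) s)} := by
    ext ω
    simp only [Set.mem_preimage, Set.mem_singleton_iff, funext_iff, Set.mem_ofPred_eq]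
    constructor
    · intro h s hs
      rw [← h]
      simp [Nat.mod_eq_of_lt (Nat.lt_succ_of_le hs)]
    · intro h s
      rw [h s (Nat.lt_succ_iff.1 s.2)]
      simp
  rw [hset, hZ.real_path t fun s => i (Fin.ofNat (t + 1) s), pathWeight, Finset.prod_range]
  congr 1
  refine Finset.prod_congr rfl fun s _ => ?_
  congr 2 <;> ext <;> simp [Nat.mod_eq_of_lt]

theorem IsStationaryReversibleMarkovChain.isReversibleKernel
    (hZ : IsStationaryReversibleMarkovChain μ A Z) :
    IsReversibleKernel (fun j => μ.real {ω | Z 0 ω = j}) A where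
  weight_nonneg _ := measureReal_nonneg
  nonneg := (Matrix.mem_rowStochastic.1 hZ.stochastic).1
  sum_row i := by
    simpa [Matrix.mulVec, dotProduct] using
      congrFun (Matrix.mem_rowStochastic.1 hZ.stochastic).2 i
  reversible := hZ.reversible

theorem IsMarkovChain.integral_step [IsProbabilityMeasure μ] (hZ : IsMarkovChain μ A Z)
    {X : Type*} [NormedAddCommGroup X] (f : Fin n → X) (p : ℝ) :
    ∫ ω, ‖f (Z 1 ω) - f (Z 0 ω)‖ ^ p ∂μ =
      stepMoment (fun j => μ.real {ω | Z 0 ω = j}) A f p := by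
  have h := hZ.integral_path 1 fun i => ‖f (i 1) - f (i 0)‖ ^ p
  refine h.trans ?_
  rw [sum_path_snoc, ← (Equiv.funUnique (Fin 1) (Fin n)).symm.sum_comp]
  refine Finset.sum_congr rfl fun i _ => ?_
  have e1 : ∀ j : Fin n, (Fin.snoc ((Equiv.funUnique (Fin 1) (Fin n)).symm i) j :
      Fin 2 → Fin n) 1 = j := fun j => Fin.snoc_last (n := 1) (α := fun _ => Fin n) _ _
  have e0 : ∀ j : Fin n, (Fin.snoc ((Equiv.funUnique (Fin 1) (Fin n)).symm i) j :
      Fin 2 → Fin n) 0 = i := fun j =>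
    Fin.snoc_castSucc (n := 1) (α := fun _ => Fin n) (i := 0) _ _
  simp only [e0, e1]
  simp [pathWeight]

/-- Moment growth for stationary reversible chains in a space satisfying a one-parameter family of
smoothness inequalities. -/
theorem IsStationaryReversibleMarkovChain.integral_norm_sub_rpow_le [IsProbabilityMeasure μ]
    (hZ : IsStationaryReversibleMarkovChain μ A Z)
    {X : Type*} [NormedAddCommGroup X] [NormedSpace ℝ X] {p r K : ℝ} (hp : 1 ≤ p)
    (hr : 1 ≤ r) (hK : 1 ≤ K)
    (hX : ∀ m : ℝ, 1 ≤ m → ∀ x y : X, ‖x + y‖ ^ p + ‖x - y‖ ^ p ≤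
      2 * (1 + 1 / (2 * m)) * ‖x‖ ^ p + 2 * K * m ^ (r - 1) * ‖y‖ ^ p)
    (f : Fin n → X) (t : ℕ) :
    ∫ ω, ‖f (Z t ω) - f (Z 0 ω)‖ ^ p ∂μ ≤
      4 ^ p * (16 * 4 ^ p + 2) * K * (t : ℝ) ^ r * ∫ ω, ‖f (Z 1 ω) - f (Z 0 ω)‖ ^ p ∂μ := by
  have hM := hZ.toIsMarkovChain
  rw [hM.integral_step f p]
  refine le_trans (le_of_eq ?_) (hZ.isReversibleKernel.sum_path_norm_sub_rpow_le hp hr hK hX f t)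
  exact hM.integral_path t fun i => ‖f (i (Fin.last t)) - f (i 0)‖ ^ p

end Chains


/-! ### Moments of increments and Markov type -/

theorem mainTheorem8 (p q : ℝ) (hp : 1 < p) (hq : 1 < q) (hq2 : q ≤ 2) :
    ∃ C : ℝ, 0 < C ∧
      ∀ (X : Type u) [NormedAddCommGroup X] [NormedSpace ℝ X], HasSmoothnessPowerType X q →
        (p ≤ q →
          (∀ (Ω : Type v) [MeasurableSpace Ω] (μ : Measure Ω) [IsProbabilityMeasure μ]
            (n : ℕ) (A : Matrix (Fin n) (Fin n) ℝ) (Z : ℕ → Ω → Fin n),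
            IsStationaryReversibleMarkovChain μ A Z →
            ∀ (f : Fin n → X) (t : ℕ),
              ∫ ω, ‖f (Z t ω) - f (Z 0 ω)‖ ^ p ∂μ ≤
                C * smoothnessConst X q ^ q * (t : ℝ) *
                  ∫ ω, ‖f (Z 1 ω) - f (Z 0 ω)‖ ^ p ∂μ) ∧
          HasMarkovType.{u, v} X p) ∧
        (q < p →
          ∀ (Ω : Type v) [MeasurableSpace Ω] (μ : Measure Ω) [IsProbabilityMeasure μ]
            (n : ℕ) (A : Matrix (Fin n) (Fin n) ℝ) (Z : ℕ → Ω → Fin n),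
            IsStationaryReversibleMarkovChain μ A Z →
            ∀ (f : Fin n → X) (t : ℕ),
              ∫ ω, ‖f (Z t ω) - f (Z 0 ω)‖ ^ p ∂μ ≤
                C * smoothnessConst X q ^ p * (t : ℝ) ^ (p / q) *
                  ∫ ω, ‖f (Z 1 ω) - f (Z 0 ω)‖ ^ p ∂μ) := by
  have hp0 : 0 < p := by linarith
  have hq0 : 0 < q := by linarith
  set B : ℝ := 4 ^ p * (16 * 4 ^ p + 2) with hB
  set b : ℝ := (2 * (p + (2 ^ p + 1) * p ^ 2)) ^ (p / q) with hb
  have hB0 : 0 < B := by positivity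
  have hb1 : 1 ≤ b := by
    have : 0 ≤ (2 ^ p + 1) * p ^ 2 := by positivity
    exact Real.one_le_rpow (by linarith) (by positivity)
  have hBb : B ≤ B * b := le_mul_of_one_le_right hB0.le hb1
  refine ⟨B * b, by positivity, fun X _ _ hX => ?_⟩
  obtain ⟨hS0, hS⟩ := hX.smoothnessConst_spec hq hq2
  set S := smoothnessConst X q with hSdef
  refine ⟨fun hpq => ?_, fun hqp Ω _ μ _ n A Z hZ f t => ?_⟩
  · have main : ∀ (Ω : Type v) [MeasurableSpace Ω] (μ : Measure Ω) [IsProbabilityMeasure μ]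
        (n : ℕ) (A : Matrix (Fin n) (Fin n) ℝ) (Z : ℕ → Ω → Fin n),
        IsStationaryReversibleMarkovChain μ A Z → ∀ (f : Fin n → X) (t : ℕ),
          ∫ ω, ‖f (Z t ω) - f (Z 0 ω)‖ ^ p ∂μ ≤
            B * b * S ^ q * (t : ℝ) * ∫ ω, ‖f (Z 1 ω) - f (Z 0 ω)‖ ^ p ∂μ := by
      intro Ω _ μ _ n A Z hZ f t
      -- In the zero space the smoothness constant is `0` and both sides vanish.
      rcases subsingleton_or_nontrivial X with hsub | hnt
      · simp [Subsingleton.elim _ (0 : X), Real.zero_rpow hp0.ne']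
      have hS1 := one_le_of_smooth hq0 hS0 hS
      have h := hZ.integral_norm_sub_rpow_le hp.le le_rfl (Real.one_le_rpow hS1 hp0.le)
        (fun m hm x y => by
          have h1 := smooth_of_le hp0 hpq hS0 hS x y
          have h2 : 0 ≤ 1 / (2 * m) * ‖x‖ ^ p := by positivity
          rw [sub_self, Real.rpow_zero]
          linarith) f t
      rw [Real.rpow_one] at h
      refine h.trans (mul_le_mul_of_nonneg_right ?_ (integral_nonneg fun ω => by positivity))
      have hSpq : S ^ p ≤ S ^ q := Real.rpow_le_rpow_of_exponent_le hS1 hpq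
      gcongr
    refine ⟨main, (B * b * S ^ q + 1) ^ p⁻¹, by positivity, fun Ω _ μ _ n A Z hZ f t => ?_⟩
    rw [Real.rpow_inv_rpow (by positivity) hp0.ne']
    simp only [dist_eq_norm]
    refine (main Ω μ n A Z hZ f t).trans
      (mul_le_mul_of_nonneg_right ?_ (integral_nonneg fun ω => by positivity))
    gcongr
    linarith
  · rcases subsingleton_or_nontrivial X with hsub | hnt
    · simp [Subsingleton.elim _ (0 : X), Real.zero_rpow hp0.ne']
    have hS1 := one_le_of_smooth hq0 hS0 hS
    have h := hZ.integral_norm_sub_rpow_le hp.le ((one_le_div hq0).2 hqp.le)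
      (one_le_mul_of_one_le_of_one_le hb1 (Real.one_le_rpow hS1 hp0.le))
      (fun m hm x y => norm_rpow_add_norm_rpow_le_of_smooth hq hq2 hqp hS1 hS hm x y) f t
    rwa [← mul_assoc] at h
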